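/- Let $0<q<1$ and let $\nu>-1$ be real with $\nu\notin\{1,2,3,\dots\}$. Put $\mathbb R_q^+=\{q^n: n\in\mathbb Z\}$, $(a;p)_n=\prod_{i=0}^{n-1}(1-ap^i)$ for $n=0,1,\dots,\infty$, $\int_0^\infty f(x)\,d_qx=(1-q)\sum_{n\in\mathbb Z}q^nf(q^n)$, $$j_\nu(x,q^2)=\sum_{n=0}^\infty(-1)^n\frac{q^{n(n+1)}}{(q^2;q^2)_n(q^{2\nu+2};q^2)_n}x^{2n},\qquad c_{q,\nu}=\frac1{1-q}\frac{(q^{2\nu+2};q^2)_\infty}{(q^2;q^2)_\infty}.$$ Let $L^1_{q,\nu}$ be the set of real functions $f$ on $\mathbb R_q^+$ with $\int_0^\infty|f(x)|x^{2\nu+1}d_qx<\infty$, and let $\mathcal F_{q,\nu}f(x)=c_{q,\nu}\int_0^\infty f(t)j_\nu(xt,q^2)t^{2\nu+1}d_qt$ for $x\in\mathbb R_q^+$ be the $q$-Bessel Fourier transform. Then for every $x\in\mathbb R_q^+$ the $q$-integral defining the $q$-Macdonald function $$K_\nu(x,q^2)=c_{q,\nu}\int_0^\infty\frac{1}{1+t^2}\,j_\nu(tx,q^2)\,t^{2\nu+1}d_qt$$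 converges absolutely; the function $K_\nu(\cdot,q^2)$ belongs to $L^1_{q,\nu}$; and for every $x\in\mathbb R_q^+$ the $q$-integral defining $\mathcal F_{q,\nu}(K_\nu)(x)$ converges absolutely and $$\mathcal F_{q,\nu}(K_\nu)(x)=\frac1{1+x^2}.$$ -/

import Mathlib

noncomputable section

namespace QBessel

/-- The `q`-half-line `{q ^ n : n ∈ ℤ}`. -/
def qHalfLine (q : ℝ) : Set ℝ := Set.range fun n : ℤ => q ^ n

/-- The finite `q`-shifted factorial `(a; p)_n = ∏_{i < n} (1 - a p ^ i)`. -/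
def qPoch (a p : ℝ) (n : ℕ) : ℝ := ∏ i ∈ Finset.range n, (1 - a * p ^ i)

/-- The infinite `q`-shifted factorial `(a; p)_∞ = ∏_{i ≥ 0} (1 - a p ^ i)`
(the product converges for `0 < p < 1`). -/
def qPochInf (a p : ℝ) : ℝ := ∏' i : ℕ, (1 - a * p ^ i)

/-- The normalized Hahn–Exton (third Jackson) `q`-Bessel function `j_ν(x; p)`, in base `p`:
`∑ (-1)^n p^{n(n+1)/2} / ((p; p)_n (p^{ν+1}; p)_n) x^{2n}`.
The series converges for all `x` when `0 < p < 1` and `ν > -1`;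
the natural-number division by `2` is exact. -/
def besselj (ν x p : ℝ) : ℝ :=
  ∑' n : ℕ, (-1) ^ n * p ^ (n * (n + 1) / 2) / (qPoch p p n * qPoch (p ^ (ν + 1)) p n)
    * x ^ (2 * n)

/-- (Absolute) convergence of the Jackson `q`-integral of `f` over `(0, ∞)`. -/
def JacksonIntegrable (q : ℝ) (f : ℝ → ℝ) : Prop :=
  Summable fun n : ℤ => q ^ n * f (q ^ n)

/-- The Jackson `q`-integral `∫_0^∞ f(x) d_q x = (1 - q) ∑_{n ∈ ℤ} q^n f(q^n)`. -/
def jacksonIntegral (q : ℝ) (f : ℝ → ℝ) : ℝ :=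
  (1 - q) * ∑' n : ℤ, q ^ n * f (q ^ n)

/-- The space `L^p_{q,ν}` of real functions `f` on the `q`-half-line with
`∫_0^∞ |f(x)|^p x^{2ν+1} d_q x < ∞`. Only the values of `f` at the points `q ^ n` matter. -/
def qLp (q p ν : ℝ) : Set (ℝ → ℝ) :=
  {f | JacksonIntegrable q fun x => |f x| ^ p * x ^ (2 * ν + 1)}

/-- The constant `c_{q,ν} = (q^{2ν+2}; q²)_∞ / ((1 - q) (q²; q²)_∞)`. -/
def cConst (q ν : ℝ) : ℝ :=
  1 / (1 - q) * (qPochInf (q ^ (2 * ν + 2)) (q ^ 2) / qPochInf (q ^ 2) (q ^ 2))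

/-- The integrand `t ↦ f(t) j_ν(x t; q²) t^{2ν+1}` of the `q`-Bessel Fourier transform. -/
def fourierIntegrand (q ν : ℝ) (f : ℝ → ℝ) (x : ℝ) : ℝ → ℝ :=
  fun t => f t * besselj ν (x * t) (q ^ 2) * t ^ (2 * ν + 1)

/-- The `q`-Bessel Fourier transform
`F_{q,ν} f(x) = c_{q,ν} ∫_0^∞ f(t) j_ν(x t; q²) t^{2ν+1} d_q t`. -/
def qFourier (q ν : ℝ) (f : ℝ → ℝ) (x : ℝ) : ℝ :=
  cConst q ν * jacksonIntegral q (fourierIntegrand q ν f x)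

/-- The integrand `t ↦ (1 + t²)⁻¹ j_ν(t x; q²) t^{2ν+1}` of the `q`-Macdonald function. -/
def macdonaldIntegrand (q ν x : ℝ) : ℝ → ℝ :=
  fun t => (1 + t ^ 2)⁻¹ * besselj ν (t * x) (q ^ 2) * t ^ (2 * ν + 1)

/-- The `q`-Macdonald function
`K_ν(x; q²) = c_{q,ν} ∫_0^∞ (1 + t²)⁻¹ j_ν(t x; q²) t^{2ν+1} d_q t`. -/
def macdonaldK (q ν x : ℝ) : ℝ :=
  cConst q ν * jacksonIntegral q (macdonaldIntegrand q ν x)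

end QBessel

end

/-!
Put `p = q ^ 2` and `w = p ^ (ν + 1)`. On the lattice, `c_{q,ν} (1 - q) j_ν(q ^ m; q ^ 2)` is the
`m`-th Laurent coefficient `J m` of `G z = (w / z; p)_∞ / (z; p)_∞` in the annulus `0 < |z| < 1`:
this is the symmetry in `w` and `z` of the double series
`∑ₙₖ eₙ eₖ wⁿ zᵏ pⁿᵏ = ∑ₙ eₙ wⁿ (z pⁿ; p)_∞`, where `eₙ` are the coefficients of Euler's expansion
of `(z; p)_∞`.

The identity `G z * G (w / z) = 1` says that `∑ₘ wᵐ J m J (m + s)` is `1` for `s = 0` and `0`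
otherwise, so the transform is formally its own inverse. Since `J` is bounded and decays faster than
any exponential as `m → -∞`, Fubini's theorem justifies the inversion for every function with a
power bound `τ ^ n`, `τ > 1`, `w τ < 1`, at `q ^ n`; the function `1 / (1 + t ^ 2)` has one.

The same bound gives the integrability of the transform at the origin. At infinity one uses that
constants have zero transform, because `G w = (1; p)_∞ / (w; p)_∞ = 0`: hence `f` and `f - f 0` have
the same transform, and `f - f 0` is small at the origin.
-/

noncomputable section

namespace QBessel

open Filter Topology

/-! ### Shifted factorials -/

section ShiftedFactorial

variable {a p : ℝ}

theorem qPoch_zero (a p : ℝ) : qPoch a p 0 = 1 :=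
  Finset.prod_range_zero _

theorem qPoch_succ (a p : ℝ) (n : ℕ) : qPoch a p (n + 1) = qPoch a p n * (1 - a * p ^ n) :=
  Finset.prod_range_succ _ n

theorem one_sub_mul_pow_pos (hp0 : 0 ≤ p) (hp1 : p ≤ 1) (ha : a < 1) (n : ℕ) :
    0 < 1 - a * p ^ n := by
  have hpn0 : 0 ≤ p ^ n := pow_nonneg hp0 n
  have hpn1 : p ^ n ≤ 1 := pow_le_one₀ hp0 hp1
  rcases le_total 0 a with ha0 | ha0
  · exact sub_pos.2 ((mul_le_of_le_one_right ha0 hpn1).trans_lt ha)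
  · exact sub_pos.2 ((mul_nonpos_of_nonpos_of_nonneg ha0 hpn0).trans_lt one_pos)

theorem qPoch_pos (hp0 : 0 ≤ p) (hp1 : p ≤ 1) (ha : a < 1) (n : ℕ) : 0 < qPoch a p n :=
  Finset.prod_pos fun i _ => one_sub_mul_pow_pos hp0 hp1 ha i

theorem qPoch_le_one (hp0 : 0 ≤ p) (hp1 : p ≤ 1) (ha0 : 0 ≤ a) (ha1 : a ≤ 1) (n : ℕ) :
    qPoch a p n ≤ 1 :=
  Finset.prod_le_one
    (fun i _ => sub_nonneg.2 (mul_le_one₀ ha1 (pow_nonneg hp0 i) (pow_le_one₀ hp0 hp1)))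
    fun i _ => sub_le_self _ (mul_nonneg ha0 (pow_nonneg hp0 i))

theorem summable_mul_pow (hp0 : 0 ≤ p) (hp1 : p < 1) (a : ℝ) : Summable fun i : ℕ => a * p ^ i :=
  (summable_geometric_of_lt_one hp0 hp1).mul_left a

theorem multipliable_one_sub_mul_pow (hp0 : 0 ≤ p) (hp1 : p < 1) (a : ℝ) :
    Multipliable fun i : ℕ => 1 - a * p ^ i := by
  simpa only [sub_eq_add_neg] using
    Real.multipliable_one_add_of_summable (summable_mul_pow hp0 hp1 a).neg

theorem tendsto_qPoch (hp0 : 0 ≤ p) (hp1 : p < 1) (a : ℝ) :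
    Tendsto (qPoch a p) atTop (𝓝 (qPochInf a p)) :=
  (multipliable_one_sub_mul_pow hp0 hp1 a).tendsto_prod_tprod_nat

theorem qPochInf_ne_zero (hp0 : 0 ≤ p) (hp1 : p < 1) (ha : a < 1) : qPochInf a p ≠ 0 := by
  have hfactor (i : ℕ) : 1 + -(a * p ^ i) ≠ 0 := by
    simpa only [← sub_eq_add_neg] using (one_sub_mul_pow_pos hp0 hp1.le ha i).ne'
  simpa only [qPochInf, sub_eq_add_neg] using
    tprod_one_add_ne_zero_of_summable hfactor (summable_mul_pow hp0 hp1 a).neg.norm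

theorem qPochInf_pos (hp0 : 0 ≤ p) (hp1 : p < 1) (ha : a < 1) : 0 < qPochInf a p :=
  (ge_of_tendsto' (tendsto_qPoch hp0 hp1 a)
    fun n => (qPoch_pos hp0 hp1.le ha n).le).lt_of_ne' (qPochInf_ne_zero hp0 hp1 ha)

theorem qPochInf_le_one (hp0 : 0 ≤ p) (hp1 : p < 1) (ha0 : 0 ≤ a) (ha1 : a ≤ 1) :
    qPochInf a p ≤ 1 :=
  le_of_tendsto' (tendsto_qPoch hp0 hp1 a) (qPoch_le_one hp0 hp1.le ha0 ha1)

theorem qPochInf_eq_qPoch_mul (hp0 : 0 ≤ p) (hp1 : p < 1) (a : ℝ) (n : ℕ) :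
    qPochInf a p = qPoch a p n * qPochInf (a * p ^ n) p := by
  have hsplit (k : ℕ) : qPoch a p (n + k) = qPoch a p n * qPoch (a * p ^ n) p k := by
    simp only [qPoch, Finset.prod_range_add, pow_add, mul_assoc]
  have htail := (tendsto_qPoch hp0 hp1 (a * p ^ n)).const_mul (qPoch a p n)
  refine tendsto_nhds_unique ((tendsto_qPoch hp0 hp1 a).comp (tendsto_add_atTop_nat n))
    (htail.congr fun k => ?_)
  rw [Function.comp_apply, add_comm, hsplit]

theorem qPochInf_eq_one_sub_mul (hp0 : 0 ≤ p) (hp1 : p < 1) (a : ℝ) :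
    qPochInf a p = (1 - a) * qPochInf (a * p) p := by
  simpa only [qPoch_succ, qPoch_zero, pow_zero, pow_one, one_mul, mul_one] using
    qPochInf_eq_qPoch_mul hp0 hp1 a 1

theorem qPochInf_inv_pow (hp0 : p ≠ 0) (n : ℕ) : qPochInf (p ^ n)⁻¹ p = 0 :=
  tprod_of_exists_eq_zero ⟨n, by rw [inv_mul_cancel₀ (pow_ne_zero n hp0), sub_self]⟩

end ShiftedFactorial

/-! ### Euler's expansions -/

section Euler

variable {p : ℝ}

/-- The coefficient of `z ^ n` in Euler's expansion of `(z; p)_∞`. -/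
def eulerCoeff (p : ℝ) (n : ℕ) : ℝ := (-1) ^ n * p ^ n.choose 2 / qPoch p p n

/-- The coefficient `1 / (p; p)_j` of `z ^ j` in Euler's expansion of `1 / (z; p)_∞`, written as a
ratio of infinite products so that it makes sense for every integer `j` and vanishes for `j < 0`. -/
def invEulerCoeff (p : ℝ) (j : ℤ) : ℝ := qPochInf (p ^ (j + 1)) p / qPochInf p p

theorem eulerCoeff_zero (p : ℝ) : eulerCoeff p 0 = 1 := by
  simp [eulerCoeff, qPoch_zero]

theorem eulerCoeff_succ_mul (hp0 : 0 < p) (hp1 : p < 1) (n : ℕ) :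
    eulerCoeff p (n + 1) * (1 - p ^ (n + 1)) = -(p ^ n * eulerCoeff p n) := by
  have hn : qPoch p p n ≠ 0 := (qPoch_pos hp0.le hp1.le hp1 n).ne'
  have hfactor : 1 - p * p ^ n ≠ 0 := (one_sub_mul_pow_pos hp0.le hp1.le hp1 n).ne'
  rw [eulerCoeff, eulerCoeff, qPoch_succ, Nat.choose_succ_succ' n 1, Nat.choose_one_right, pow_add,
    pow_succ (-1 : ℝ), pow_succ' p n]
  field_simp
  ring

theorem summable_eulerCoeff_mul_pow (hp0 : 0 < p) (hp1 : p < 1) (z : ℝ) :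
    Summable fun n : ℕ => eulerCoeff p n * z ^ n := by
  have hratio (n : ℕ) : eulerCoeff p (n + 1) * z ^ (n + 1) =
      -(z * p ^ n / (1 - p * p ^ n)) * (eulerCoeff p n * z ^ n) := by
    have hfactor : 1 - p * p ^ n ≠ 0 := (one_sub_mul_pow_pos hp0.le hp1.le hp1 n).ne'
    have hsucc := eulerCoeff_succ_mul hp0 hp1 n
    rw [pow_succ'] at hsucc
    rw [← mul_div_cancel_right₀ (eulerCoeff p (n + 1)) hfactor, hsucc]
    ring
  have hlim : Tendsto (fun n : ℕ => ‖-(z * p ^ n / (1 - p * p ^ n))‖) atTop (𝓝 0) := by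
    have hpow := tendsto_pow_atTop_nhds_zero_of_lt_one hp0.le hp1
    simpa using ((hpow.const_mul z).div ((hpow.const_mul p).const_sub 1) (by simp)).neg.norm
  refine summable_of_ratio_norm_eventually_le (r := 1 / 2) (by norm_num) ?_
  filter_upwards [hlim.eventually_le_const (by norm_num : (0 : ℝ) < 1 / 2)] with n hn
  rw [hratio, norm_mul]
  gcongr

theorem tsum_eulerCoeff_mul_pow_eq_mul (hp0 : 0 < p) (hp1 : p < 1) (z : ℝ) :
    ∑' n : ℕ, eulerCoeff p n * z ^ n = (1 - z) * ∑' n : ℕ, eulerCoeff p n * (z * p) ^ n := by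
  have hz := summable_eulerCoeff_mul_pow hp0 hp1 z
  have hzp := summable_eulerCoeff_mul_pow hp0 hp1 (z * p)
  have hdiff : ∑' n : ℕ, eulerCoeff p n * z ^ n - ∑' n : ℕ, eulerCoeff p n * (z * p) ^ n =
      -z * ∑' n : ℕ, eulerCoeff p n * (z * p) ^ n := by
    rw [← hz.tsum_sub hzp, (hz.sub hzp).tsum_eq_zero_add, ← tsum_mul_left]
    simp only [pow_zero, sub_self, zero_add]
    refine tsum_congr fun n => ?_
    rw [mul_pow, mul_pow]
    linear_combination z ^ (n + 1) * eulerCoeff_succ_mul hp0 hp1 n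
  linear_combination hdiff

theorem tendsto_tsum_eulerCoeff_mul_pow (hp0 : 0 < p) (hp1 : p < 1) (z : ℝ) :
    Tendsto (fun k : ℕ => ∑' n : ℕ, eulerCoeff p n * (z * p ^ k) ^ n) atTop (𝓝 1) := by
  have hzero : ∑' n : ℕ, eulerCoeff p n * (z * 0) ^ n = 1 := by
    rw [tsum_eq_single 0 fun n hn => by simp [hn], eulerCoeff_zero, pow_zero, one_mul]
  rw [← hzero]
  refine tendsto_tsum_of_dominated_convergence (summable_eulerCoeff_mul_pow hp0 hp1 z).norm
    (fun n => (((tendsto_pow_atTop_nhds_zero_of_lt_one hp0.le hp1).const_mul z).pow n).const_mul _)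
    (Eventually.of_forall fun k n => ?_)
  have hpk : ‖p ^ k‖ ≤ 1 := by
    simpa only [Real.norm_of_nonneg (pow_pos hp0 k).le] using pow_le_one₀ hp0.le hp1.le
  rw [norm_mul, norm_mul, norm_pow, norm_pow, norm_mul]
  gcongr
  exact mul_le_of_le_one_right (norm_nonneg z) hpk

theorem tsum_eulerCoeff_mul_pow (hp0 : 0 < p) (hp1 : p < 1) (z : ℝ) :
    ∑' n : ℕ, eulerCoeff p n * z ^ n = qPochInf z p := by
  have hiter (k : ℕ) : ∑' n : ℕ, eulerCoeff p n * z ^ n =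
      qPoch z p k * ∑' n : ℕ, eulerCoeff p n * (z * p ^ k) ^ n := by
    induction k with
    | zero => simp only [qPoch_zero, pow_zero, mul_one, one_mul]
    | succ k ih =>
      rw [ih, tsum_eulerCoeff_mul_pow_eq_mul hp0 hp1 (z * p ^ k), qPoch_succ, pow_succ, mul_assoc,
        mul_assoc]
  have hlim := (tendsto_qPoch hp0.le hp1 z).mul (tendsto_tsum_eulerCoeff_mul_pow hp0 hp1 z)
  rw [mul_one] at hlim
  exact tendsto_nhds_unique tendsto_const_nhds (hlim.congr fun k => (hiter k).symm)

theorem summable_eulerCoeff (hp0 : 0 < p) (hp1 : p < 1) : Summable (eulerCoeff p) := by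
  simpa only [one_pow, mul_one] using summable_eulerCoeff_mul_pow hp0 hp1 1

theorem tsum_eulerCoeff (hp0 : 0 < p) (hp1 : p < 1) : ∑' n : ℕ, eulerCoeff p n = 0 := by
  have hroot : qPochInf 1 p = 0 := by
    simpa only [pow_zero, inv_one] using qPochInf_inv_pow hp0.ne' 0
  simpa only [one_pow, mul_one, hroot] using tsum_eulerCoeff_mul_pow hp0 hp1 1

theorem invEulerCoeff_zero (hp0 : 0 ≤ p) (hp1 : p < 1) : invEulerCoeff p 0 = 1 := by
  rw [invEulerCoeff, zero_add, zpow_one, div_self (qPochInf_ne_zero hp0 hp1 hp1)]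

theorem invEulerCoeff_of_neg (hp0 : p ≠ 0) {j : ℤ} (hj : j < 0) : invEulerCoeff p j = 0 := by
  obtain ⟨n, rfl⟩ := Int.eq_negSucc_of_lt_zero hj
  have hexp : Int.negSucc n + 1 = -(n : ℤ) := by lia
  rw [invEulerCoeff, hexp, zpow_neg, zpow_natCast, qPochInf_inv_pow hp0, zero_div]

theorem invEulerCoeff_nonneg (hp0 : 0 < p) (hp1 : p < 1) (j : ℤ) : 0 ≤ invEulerCoeff p j := by
  rcases lt_or_ge j 0 with hj | hj
  · exact (invEulerCoeff_of_neg hp0.ne' hj).ge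
  · have hpj : p ^ (j + 1) < 1 := zpow_lt_one₀ hp0 hp1 (by lia)
    exact (div_pos (qPochInf_pos hp0.le hp1 hpj) (qPochInf_pos hp0.le hp1 hp1)).le

theorem invEulerCoeff_le (hp0 : 0 < p) (hp1 : p < 1) (j : ℤ) :
    invEulerCoeff p j ≤ (qPochInf p p)⁻¹ := by
  have hpos : 0 < (qPochInf p p)⁻¹ := inv_pos.2 (qPochInf_pos hp0.le hp1 hp1)
  rcases lt_or_ge j 0 with hj | hj
  · exact (invEulerCoeff_of_neg hp0.ne' hj).trans_le hpos.le
  · have hpj : p ^ (j + 1) ≤ 1 := zpow_le_one₀ hp0 hp1.le (by lia)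
    rw [invEulerCoeff, div_eq_mul_inv]
    exact mul_le_of_le_one_left hpos.le
      (qPochInf_le_one hp0.le hp1 (zpow_pos hp0 _).le hpj)

theorem abs_invEulerCoeff_le (hp0 : 0 < p) (hp1 : p < 1) (j : ℤ) :
    |invEulerCoeff p j| ≤ (qPochInf p p)⁻¹ :=
  (abs_of_nonneg (invEulerCoeff_nonneg hp0 hp1 j)).trans_le (invEulerCoeff_le hp0 hp1 j)

theorem invEulerCoeff_sub_one (hp0 : 0 < p) (hp1 : p < 1) (j : ℤ) :
    invEulerCoeff p (j - 1) = (1 - p ^ j) * invEulerCoeff p j := by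
  rw [invEulerCoeff, sub_add_cancel, qPochInf_eq_one_sub_mul hp0.le hp1, ← zpow_add_one₀ hp0.ne',
    mul_div_assoc, invEulerCoeff]

theorem summable_mul_invEulerCoeff (hp0 : 0 < p) (hp1 : p < 1) {ι : Type*} {b : ι → ℝ}
    (hb : Summable b) (j : ι → ℤ) : Summable fun i => b i * invEulerCoeff p (j i) :=
  (hb.norm.mul_right (qPochInf p p)⁻¹).of_norm_bounded fun i => by
    rw [norm_mul]
    exact mul_le_mul_of_nonneg_left (abs_invEulerCoeff_le hp0 hp1 _) (norm_nonneg _)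

/-- Coefficientwise, `z * A = A - B` for `A = (z p; p)_∞ / (z; p)_∞` and
`B = (z; p)_∞ / (z; p)_∞`. -/
theorem tsum_pow_mul_eulerCoeff_mul_invEulerCoeff_sub (hp0 : 0 < p) (hp1 : p < 1) (u : ℤ) :
    ∑' r : ℕ, eulerCoeff p r * p ^ r * invEulerCoeff p (u - 1 - r) =
      ∑' r : ℕ, eulerCoeff p r * p ^ r * invEulerCoeff p (u - r) -
        ∑' r : ℕ, eulerCoeff p r * invEulerCoeff p (u - r) := by
  have hpow := summable_mul_invEulerCoeff hp0 hp1 (summable_eulerCoeff_mul_pow hp0 hp1 p)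
    fun r : ℕ => u - r
  have hone := summable_mul_invEulerCoeff hp0 hp1 (summable_eulerCoeff hp0 hp1) fun r : ℕ => u - r
  rw [← hpow.tsum_sub hone, (hpow.sub hone).tsum_eq_zero_add, pow_zero, mul_one, sub_self, zero_add]
  refine tsum_congr fun r => ?_
  have hindex : u - (r + 1 : ℕ) = u - 1 - r := by push_cast; ring
  rw [hindex]
  linear_combination invEulerCoeff p (u - 1 - r) * eulerCoeff_succ_mul hp0 hp1 r

/-- Coefficientwise, `(z; p)_∞ · (z; p)_∞⁻¹ = 1`. -/
theorem tsum_eulerCoeff_mul_invEulerCoeff_sub (hp0 : 0 < p) (hp1 : p < 1) (u : ℤ) :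
    ∑' r : ℕ, eulerCoeff p r * invEulerCoeff p (u - r) = if u = 0 then 1 else 0 := by
  split_ifs with hu
  · subst hu
    rw [tsum_eq_single 0 fun r hr => by rw [invEulerCoeff_of_neg hp0.ne' (by lia), mul_zero],
      eulerCoeff_zero, Nat.cast_zero, sub_zero, invEulerCoeff_zero hp0.le hp1, one_mul]
  · have hpow := summable_mul_invEulerCoeff hp0 hp1 (summable_eulerCoeff_mul_pow hp0 hp1 p)
      fun r : ℕ => u - r
    have hone := summable_mul_invEulerCoeff hp0 hp1 (summable_eulerCoeff hp0 hp1)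
      fun r : ℕ => u - r
    have hstep : ∑' r : ℕ, eulerCoeff p r * p ^ r * invEulerCoeff p (u - 1 - r) =
        ∑' r : ℕ, eulerCoeff p r * p ^ r * invEulerCoeff p (u - r) -
          p ^ u * ∑' r : ℕ, eulerCoeff p r * invEulerCoeff p (u - r) := by
      rw [← tsum_mul_left, ← hpow.tsum_sub (hone.mul_left _)]
      refine tsum_congr fun r => ?_
      rw [sub_right_comm, invEulerCoeff_sub_one hp0 hp1, zpow_sub₀ hp0.ne', zpow_natCast]
      field_simp
    have hpu : p ^ u - 1 ≠ 0 :=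
      sub_ne_zero.2 fun h => hu ((zpow_eq_one_iff_right₀ hp0.le hp1.ne).1 h)
    refine (mul_eq_zero.1 ?_).resolve_left hpu
    linear_combination hstep - tsum_pow_mul_eulerCoeff_mul_invEulerCoeff_sub hp0 hp1 u

end Euler

/-! ### The Bessel function on the lattice -/

section RapidlyDecaying

/-- Functions on `ℤ` that are bounded and decay faster than every exponential at `-∞`. -/
def RapidlyDecaying (f : ℤ → ℝ) : Prop :=
  ∀ B : ℝ, 1 ≤ B → ∃ C, ∀ m, |f m| ≤ C * B ^ m

variable {f : ℤ → ℝ}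

theorem RapidlyDecaying.comp_add_right (hf : RapidlyDecaying f) (s : ℤ) :
    RapidlyDecaying fun m => f (m + s) := by
  intro B hB
  obtain ⟨C, hC⟩ := hf B hB
  refine ⟨C * B ^ s, fun m => ?_⟩
  rw [mul_assoc, ← zpow_add₀ (zero_lt_one.trans_le hB).ne', add_comm s]
  exact hC (m + s)

theorem RapidlyDecaying.exists_abs_le (hf : RapidlyDecaying f) : ∃ C, ∀ m, |f m| ≤ C := by
  simpa only [one_zpow, mul_one] using hf 1 le_rfl

theorem RapidlyDecaying.summable_zpow_mul_abs (hf : RapidlyDecaying f) {ρ : ℝ} (hρ0 : 0 < ρ)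
    (hρ1 : ρ < 1) : Summable fun m => ρ ^ m * |f m| := by
  have hterm (m : ℤ) : ‖ρ ^ m * |f m|‖ = ρ ^ m * |f m| :=
    Real.norm_of_nonneg (mul_nonneg (zpow_pos hρ0 m).le (abs_nonneg _))
  refine Summable.of_nat_of_neg ?_ ?_
  · obtain ⟨C, hC⟩ := hf.exists_abs_le
    refine ((summable_geometric_of_lt_one hρ0.le hρ1).mul_right C).of_norm_bounded fun n => ?_
    rw [hterm, zpow_natCast]
    gcongr
    exact hC n
  · obtain ⟨C, hC⟩ := hf (2 / ρ) (by rw [le_div_iff₀ hρ0]; linarith)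
    refine (summable_geometric_two.mul_right C).of_norm_bounded fun n => ?_
    rw [hterm]
    calc ρ ^ (-(n : ℤ)) * |f (-n)| ≤ ρ ^ (-(n : ℤ)) * (C * (2 / ρ) ^ (-(n : ℤ))) := by
          gcongr
          exact hC (-n)
      _ = (1 / 2) ^ n * C := by
          rw [← zpow_natCast (1 / 2 : ℝ), one_div, inv_zpow', div_zpow]
          field_simp

end RapidlyDecaying

section LatticeBessel

variable {p w : ℝ}

/-- The coefficient of `z ^ m` in the Laurent expansion of `(w / z; p)_∞ / (z; p)_∞` on
`0 < |z| < 1`. For `p = q ^ 2` and `w = p ^ (ν + 1)` it is, up to the factor `c_{q,ν} (1 - q)`, the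
value of `j_ν(· ; q ^ 2)` at the lattice point `q ^ m`. -/
def latticeBessel (p w : ℝ) (m : ℤ) : ℝ :=
  ∑' n : ℕ, eulerCoeff p n * w ^ n * invEulerCoeff p (n + m)

theorem rapidlyDecaying_invEulerCoeff (hp0 : 0 < p) (hp1 : p < 1) :
    RapidlyDecaying (invEulerCoeff p) := by
  refine fun B hB => ⟨(qPochInf p p)⁻¹, fun j => ?_⟩
  have hC : 0 < (qPochInf p p)⁻¹ := inv_pos.2 (qPochInf_pos hp0.le hp1 hp1)
  rcases lt_or_ge j 0 with hj | hj
  · rw [invEulerCoeff_of_neg hp0.ne' hj, abs_zero]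
    positivity
  · exact (abs_invEulerCoeff_le hp0 hp1 j).trans
      (le_mul_of_one_le_right hC.le (one_le_zpow₀ hB hj))

theorem rapidlyDecaying_latticeBessel (hp0 : 0 < p) (hp1 : p < 1) (w : ℝ) :
    RapidlyDecaying (latticeBessel p w) := by
  intro B hB
  have hB0 : 0 < B := zero_lt_one.trans_le hB
  obtain ⟨C, hC⟩ := rapidlyDecaying_invEulerCoeff hp0 hp1 B hB
  have hsum := (summable_eulerCoeff_mul_pow hp0 hp1 (w * B)).norm
  have hterm (m : ℤ) (n : ℕ) : ‖eulerCoeff p n * w ^ n * invEulerCoeff p (n + m)‖ ≤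
      ‖eulerCoeff p n * (w * B) ^ n‖ * (C * B ^ m) :=
    calc ‖eulerCoeff p n * w ^ n * invEulerCoeff p (n + m)‖
        ≤ ‖eulerCoeff p n * w ^ n‖ * (C * B ^ (n + m : ℤ)) := by
          rw [norm_mul]
          gcongr
          exact hC (n + m)
      _ = ‖eulerCoeff p n * (w * B) ^ n‖ * (C * B ^ m) := by
          rw [mul_pow, ← mul_assoc (eulerCoeff p n), norm_mul _ (B ^ n),
            Real.norm_of_nonneg (pow_pos hB0 n).le, zpow_add₀ hB0.ne', zpow_natCast]
          ring
  refine ⟨(∑' n : ℕ, ‖eulerCoeff p n * (w * B) ^ n‖) * C, fun m => ?_⟩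
  rw [mul_assoc, ← tsum_mul_right]
  exact tsum_of_norm_bounded (hsum.mul_right (C * B ^ m)).hasSum (hterm m)

/-- By Euler's expansion both sides are the double series with terms
`eulerCoeff p n * eulerCoeff p k * w ^ n * z ^ k * p ^ (n * k)`. -/
theorem tsum_eulerCoeff_mul_qPochInf_comm (hp0 : 0 < p) (hp1 : p < 1) (w z : ℝ) :
    ∑' n : ℕ, eulerCoeff p n * w ^ n * qPochInf (z * p ^ n) p =
      ∑' k : ℕ, eulerCoeff p k * z ^ k * qPochInf (w * p ^ k) p := by
  have hsum : Summable fun x : ℕ × ℕ =>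
      eulerCoeff p x.1 * w ^ x.1 * (eulerCoeff p x.2 * z ^ x.2) * p ^ (x.1 * x.2) := by
    refine (summable_mul_of_summable_norm (summable_eulerCoeff_mul_pow hp0 hp1 w).norm
      (summable_eulerCoeff_mul_pow hp0 hp1 z).norm).norm.of_norm_bounded fun x => ?_
    rw [norm_mul _ (p ^ _), Real.norm_of_nonneg (pow_pos hp0 _).le]
    exact mul_le_of_le_one_right (norm_nonneg _) (pow_le_one₀ hp0.le hp1.le)
  calc ∑' n : ℕ, eulerCoeff p n * w ^ n * qPochInf (z * p ^ n) p
      = ∑' (n : ℕ) (k : ℕ),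
          eulerCoeff p n * w ^ n * (eulerCoeff p k * z ^ k) * p ^ (n * k) := by
        refine tsum_congr fun n => ?_
        rw [← tsum_eulerCoeff_mul_pow hp0 hp1, ← tsum_mul_left]
        refine tsum_congr fun k => ?_
        rw [mul_pow, pow_mul]
        ring
    _ = ∑' (k : ℕ) (n : ℕ),
          eulerCoeff p n * w ^ n * (eulerCoeff p k * z ^ k) * p ^ (n * k) :=
        (Summable.tsum_comm (f := fun n k : ℕ =>
          eulerCoeff p n * w ^ n * (eulerCoeff p k * z ^ k) * p ^ (n * k)) hsum).symm
    _ = ∑' k : ℕ, eulerCoeff p k * z ^ k * qPochInf (w * p ^ k) p := by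
        refine tsum_congr fun k => ?_
        rw [← tsum_eulerCoeff_mul_pow hp0 hp1, ← tsum_mul_left]
        refine tsum_congr fun n => ?_
        rw [mul_pow, mul_comm n, pow_mul]
        ring

theorem eulerCoeff_mul_pow_mul_qPochInf (hp0 : 0 < p) (hp1 : p < 1) (hw1 : w < 1) (z : ℝ)
    (n : ℕ) :
    eulerCoeff p n * (z * p) ^ n * qPochInf (w * p ^ n) p =
      qPochInf w p *
        ((-1) ^ n * p ^ (n * (n + 1) / 2) / (qPoch p p n * qPoch w p n) * z ^ n) := by
  have hpn : qPoch p p n ≠ 0 := (qPoch_pos hp0.le hp1.le hp1 n).ne'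
  have hwn : qPoch w p n ≠ 0 := (qPoch_pos hp0.le hp1.le hw1 n).ne'
  have hexp : n * (n + 1) / 2 = n.choose 2 + n := by
    rw [mul_comm, Nat.choose_two_right]
    exact Nat.triangle_succ n
  rw [qPochInf_eq_qPoch_mul hp0.le hp1 w n, eulerCoeff, mul_pow, hexp, pow_add]
  field_simp

theorem qPochInf_div_mul_tsum_eq_latticeBessel (hp0 : 0 < p) (hp1 : p < 1) (hw1 : w < 1)
    (m : ℤ) :
    qPochInf w p / qPochInf p p *
        ∑' n : ℕ, (-1) ^ n * p ^ (n * (n + 1) / 2) / (qPoch p p n * qPoch w p n) * (p ^ m) ^ n =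
      latticeBessel p w m := by
  have hcomm := tsum_eulerCoeff_mul_qPochInf_comm hp0 hp1 w (p ^ m * p)
  simp only [eulerCoeff_mul_pow_mul_qPochInf hp0 hp1 hw1, tsum_mul_left] at hcomm
  rw [div_mul_eq_mul_div, ← hcomm, ← tsum_div_const, latticeBessel]
  refine tsum_congr fun n => ?_
  rw [invEulerCoeff, add_assoc, add_comm (n : ℤ), zpow_add₀ hp0.ne', zpow_add_one₀ hp0.ne',
    zpow_natCast, mul_div_assoc]

end LatticeBessel

/-! ### Orthogonality -/

section Shear

variable {ι G : Type*} [AddGroup G]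

theorem summable_comp_add_iff {F : ι × G → ℝ} (a : ι → G) :
    Summable (fun x : ι × G => F (x.1, x.2 + a x.1)) ↔ Summable F :=
  (Equiv.prodShear (Equiv.refl ι) fun i => Equiv.addRight (a i)).summable_iff

theorem tsum_tsum_comp_add {F : ι → G → ℝ} (hF : Summable (Function.uncurry F)) (a : ι → G) :
    ∑' (m : G) (i : ι), F i (m + a i) = ∑' (u : G) (i : ι), F i u := by
  have hshear : Summable (Function.uncurry fun i m => F i (m + a i)) :=
    (summable_comp_add_iff a).2 hF
  rw [hshear.tsum_comm, hF.tsum_comm]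
  exact tsum_congr fun i => (Equiv.addRight (a i)).tsum_eq (F i)

end Shear

section Orthogonality

variable {p w : ℝ}

theorem summable_eulerCoeff_mul_zpow_mul_invEulerCoeff (hp0 : 0 < p) (hp1 : p < 1) (hw0 : 0 < w)
    (hw1 : w < 1) :
    Summable fun x : ℕ × ℤ => eulerCoeff p x.1 * (w ^ x.2 * invEulerCoeff p x.2) := by
  have hdecay := (rapidlyDecaying_invEulerCoeff hp0 hp1).summable_zpow_mul_abs hw0 hw1
  simp only [abs_of_nonneg (invEulerCoeff_nonneg hp0 hp1 _)] at hdecay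
  exact summable_mul_of_summable_norm (summable_eulerCoeff hp0 hp1).norm hdecay.norm

/-- The value at `z = w` of `(w / z; p)_∞ / (z; p)_∞`, which vanishes because `(1; p)_∞ = 0`. -/
theorem tsum_zpow_mul_latticeBessel (hp0 : 0 < p) (hp1 : p < 1) (hw0 : 0 < w) (hw1 : w < 1) :
    ∑' m : ℤ, w ^ m * latticeBessel p w m = 0 := by
  have hsum := summable_eulerCoeff_mul_zpow_mul_invEulerCoeff hp0 hp1 hw0 hw1
  calc ∑' m : ℤ, w ^ m * latticeBessel p w m
      = ∑' (m : ℤ) (n : ℕ),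
          eulerCoeff p n * (w ^ (m + n) * invEulerCoeff p (m + n)) := by
        refine tsum_congr fun m => ?_
        rw [latticeBessel, ← tsum_mul_left]
        refine tsum_congr fun n => ?_
        rw [zpow_add₀ hw0.ne', zpow_natCast, add_comm m]
        ring
    _ = ∑' (u : ℤ) (n : ℕ), eulerCoeff p n * (w ^ u * invEulerCoeff p u) :=
        tsum_tsum_comp_add (F := fun n u => eulerCoeff p n * (w ^ u * invEulerCoeff p u)) hsum
          (Nat.cast : ℕ → ℤ)
    _ = 0 := by simp only [tsum_mul_right, tsum_eulerCoeff hp0 hp1, zero_mul, tsum_zero]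

/-- Coefficientwise, `(z; p)_∞ · ((w / z; p)_∞ / (z; p)_∞) = (w / z; p)_∞`. -/
theorem tsum_eulerCoeff_mul_latticeBessel_sub (hp0 : 0 < p) (hp1 : p < 1) (w : ℝ) (v : ℤ) :
    ∑' r : ℕ, eulerCoeff p r * latticeBessel p w (v - r) =
      ∑' n : ℕ, eulerCoeff p n * w ^ n * if n + v = 0 then 1 else 0 := by
  have hsum : Summable fun x : ℕ × ℕ => eulerCoeff p x.1 * (eulerCoeff p x.2 * w ^ x.2) *
      invEulerCoeff p (x.2 + (v - x.1)) :=
    summable_mul_invEulerCoeff hp0 hp1 (summable_mul_of_summable_norm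
      (summable_eulerCoeff hp0 hp1).norm (summable_eulerCoeff_mul_pow hp0 hp1 w).norm) _
  calc ∑' r : ℕ, eulerCoeff p r * latticeBessel p w (v - r)
      = ∑' (r : ℕ) (n : ℕ), eulerCoeff p r * (eulerCoeff p n * w ^ n) *
          invEulerCoeff p (n + (v - r)) := by
        refine tsum_congr fun r => ?_
        rw [latticeBessel, ← tsum_mul_left]
        exact tsum_congr fun n => (mul_assoc _ _ _).symm
    _ = ∑' (n : ℕ) (r : ℕ), eulerCoeff p r * (eulerCoeff p n * w ^ n) *
          invEulerCoeff p (n + (v - r)) :=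
        (Summable.tsum_comm (f := fun r n : ℕ => eulerCoeff p r * (eulerCoeff p n * w ^ n) *
          invEulerCoeff p (n + (v - r))) hsum).symm
    _ = ∑' n : ℕ, eulerCoeff p n * w ^ n * if n + v = 0 then 1 else 0 := by
        refine tsum_congr fun n => ?_
        rw [← tsum_eulerCoeff_mul_invEulerCoeff_sub hp0 hp1, ← tsum_mul_left]
        refine tsum_congr fun r => ?_
        rw [add_sub_assoc]
        ring

/-- Coefficientwise, `(w / z; p)_∞⁻¹ · (w / z; p)_∞ = 1`. -/
theorem tsum_zpow_mul_invEulerCoeff_mul_tsum (hp0 : 0 < p) (hp1 : p < 1) (hw0 : 0 < w)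
    (hw1 : w < 1) (s : ℤ) :
    ∑' u : ℤ, w ^ u * invEulerCoeff p u *
        ∑' n : ℕ, eulerCoeff p n * w ^ n * (if n + (u + s) = 0 then 1 else 0) =
      if s = 0 then 1 else 0 := by
  have hsum : Summable fun x : ℕ × ℤ => eulerCoeff p x.1 * (w ^ x.2 * invEulerCoeff p x.2) *
      (w ^ x.1 * if x.1 + (x.2 + s) = 0 then 1 else 0) := by
    refine (summable_eulerCoeff_mul_zpow_mul_invEulerCoeff hp0 hp1 hw0 hw1).norm.of_norm_bounded
      fun x => ?_
    rw [norm_mul]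
    refine mul_le_of_le_one_right (norm_nonneg _) ?_
    rw [norm_mul, norm_pow, Real.norm_of_nonneg hw0.le]
    exact mul_le_one₀ (pow_le_one₀ hw0.le hw1.le) (norm_nonneg _) (by split_ifs <;> simp)
  calc ∑' u : ℤ, w ^ u * invEulerCoeff p u *
        ∑' n : ℕ, eulerCoeff p n * w ^ n * (if n + (u + s) = 0 then 1 else 0)
      = ∑' (u : ℤ) (n : ℕ), eulerCoeff p n * (w ^ u * invEulerCoeff p u) *
          (w ^ n * if n + (u + s) = 0 then 1 else 0) := by
        refine tsum_congr fun u => ?_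
        rw [← tsum_mul_left]
        exact tsum_congr fun n => by ring
    _ = ∑' (n : ℕ) (u : ℤ), eulerCoeff p n * (w ^ u * invEulerCoeff p u) *
          (w ^ n * if n + (u + s) = 0 then 1 else 0) :=
        Summable.tsum_comm (f := fun (n : ℕ) (u : ℤ) => eulerCoeff p n *
          (w ^ u * invEulerCoeff p u) * (w ^ n * if n + (u + s) = 0 then 1 else 0)) hsum
    _ = ∑' n : ℕ, w ^ (-s) * (eulerCoeff p n * invEulerCoeff p (-s - n)) := by
        refine tsum_congr fun n => ?_
        rw [tsum_eq_single (-s - n) fun u hu => by rw [if_neg (by lia), mul_zero, mul_zero],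
          if_pos (by ring), zpow_sub₀ hw0.ne', zpow_natCast]
        field_simp
    _ = if s = 0 then 1 else 0 := by
        rw [tsum_mul_left, tsum_eulerCoeff_mul_invEulerCoeff_sub hp0 hp1]
        by_cases hs : s = 0 <;> simp [hs]

/-- Coefficientwise, `G (w / z) G z = 1` for `G z = (w / z; p)_∞ / (z; p)_∞`. -/
theorem tsum_zpow_mul_latticeBessel_mul (hp0 : 0 < p) (hp1 : p < 1) (hw0 : 0 < w) (hw1 : w < 1)
    (s : ℤ) :
    ∑' m : ℤ, w ^ m * (latticeBessel p w m * latticeBessel p w (m + s)) =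
      if s = 0 then 1 else 0 := by
  obtain ⟨C, hC⟩ := (rapidlyDecaying_latticeBessel hp0 hp1 w).exists_abs_le
  let F (r : ℕ) (u : ℤ) : ℝ :=
    eulerCoeff p r * (w ^ u * invEulerCoeff p u) * latticeBessel p w (u + s - r)
  have hF : Summable (Function.uncurry F) := by
    refine ((summable_eulerCoeff_mul_zpow_mul_invEulerCoeff hp0 hp1 hw0 hw1).norm.mul_right
      C).of_norm_bounded fun x => ?_
    rw [Function.uncurry_def, norm_mul]
    gcongr
    exact hC _
  calc ∑' m : ℤ, w ^ m * (latticeBessel p w m * latticeBessel p w (m + s))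
      = ∑' (m : ℤ) (r : ℕ), F r (m + r) := by
        refine tsum_congr fun m => ?_
        rw [latticeBessel, ← tsum_mul_right, ← tsum_mul_left]
        refine tsum_congr fun r => ?_
        simp only [F]
        rw [zpow_add₀ hw0.ne', zpow_natCast, add_right_comm, add_sub_cancel_right, add_comm m r]
        ring
    _ = ∑' (u : ℤ) (r : ℕ), F r u := tsum_tsum_comp_add hF (Nat.cast : ℕ → ℤ)
    _ = ∑' u : ℤ, w ^ u * invEulerCoeff p u *
          ∑' n : ℕ, eulerCoeff p n * w ^ n * (if n + (u + s) = 0 then 1 else 0) := by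
        refine tsum_congr fun u => ?_
        rw [← tsum_eulerCoeff_mul_latticeBessel_sub hp0 hp1, ← tsum_mul_left]
        refine tsum_congr fun r => ?_
        simp only [F]
        ring
    _ = if s = 0 then 1 else 0 := tsum_zpow_mul_invEulerCoeff_mul_tsum hp0 hp1 hw0 hw1 s

theorem tsum_zpow_mul_latticeBessel_add_mul (hp0 : 0 < p) (hp1 : p < 1) (hw0 : 0 < w)
    (hw1 : w < 1) (a b : ℤ) :
    ∑' m : ℤ, w ^ m * (latticeBessel p w (m + a) * latticeBessel p w (m + b)) =
      if a = b then w ^ (-a) else 0 := by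
  calc ∑' m : ℤ, w ^ m * (latticeBessel p w (m + a) * latticeBessel p w (m + b))
      = ∑' m : ℤ, w ^ (-a) * (w ^ m * (latticeBessel p w m * latticeBessel p w (m + (b - a)))) := by
        rw [← (Equiv.subRight a).tsum_eq]
        refine tsum_congr fun m => ?_
        rw [Equiv.subRight_apply, sub_add_cancel, sub_add_eq_add_sub, ← add_sub_assoc,
          sub_eq_neg_add, zpow_add₀ hw0.ne', mul_assoc]
    _ = if a = b then w ^ (-a) else 0 := by
        rw [tsum_mul_left, tsum_zpow_mul_latticeBessel_mul hp0 hp1 hw0 hw1, mul_ite, mul_one,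
          mul_zero]
        simp only [sub_eq_zero, eq_comm]

end Orthogonality

/-! ### Inversion on the lattice -/

section LatticeFourier

variable {p w A τ : ℝ} {u : ℤ → ℝ}

/-- The `q`-Bessel Fourier transform in lattice coordinates: for `p = q ^ 2` and `w = p ^ (ν + 1)`,
the function with values `u n` at `q ^ n` has the transform with values `latticeFourier p w u k`
at `q ^ k`. -/
def latticeFourier (p w : ℝ) (u : ℤ → ℝ) (k : ℤ) : ℝ :=
  ∑' n : ℤ, w ^ n * u n * latticeBessel p w (n + k)

theorem norm_zpow_mul_mul_latticeBessel_le (hw0 : 0 < w) (hu : ∀ n, |u n| ≤ A * τ ^ n)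
    (k n : ℤ) :
    ‖w ^ n * u n * latticeBessel p w (n + k)‖ ≤
      A * ((w * τ) ^ n * |latticeBessel p w (n + k)|) :=
  calc ‖w ^ n * u n * latticeBessel p w (n + k)‖
      = w ^ n * |u n| * |latticeBessel p w (n + k)| := by
        rw [norm_mul, norm_mul, Real.norm_of_nonneg (zpow_pos hw0 n).le, Real.norm_eq_abs,
          Real.norm_eq_abs]
    _ ≤ w ^ n * (A * τ ^ n) * |latticeBessel p w (n + k)| := by
        gcongr
        exact hu n
    _ = A * ((w * τ) ^ n * |latticeBessel p w (n + k)|) := by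
        rw [mul_zpow]
        ring

theorem summable_zpow_mul_abs_latticeBessel_add (hp0 : 0 < p) (hp1 : p < 1) (w : ℝ) {ρ : ℝ}
    (hρ0 : 0 < ρ) (hρ1 : ρ < 1) (k : ℤ) :
    Summable fun n : ℤ => ρ ^ n * |latticeBessel p w (n + k)| :=
  ((rapidlyDecaying_latticeBessel hp0 hp1 w).comp_add_right k).summable_zpow_mul_abs hρ0 hρ1

theorem summable_zpow_mul_mul_latticeBessel (hp0 : 0 < p) (hp1 : p < 1) (hw0 : 0 < w) (hτ0 : 0 < τ)
    (hwτ : w * τ < 1) (hu : ∀ n, |u n| ≤ A * τ ^ n) (k : ℤ) :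
    Summable fun n : ℤ => w ^ n * u n * latticeBessel p w (n + k) :=
  ((summable_zpow_mul_abs_latticeBessel_add hp0 hp1 w (mul_pos hw0 hτ0) hwτ k).mul_left
    A).of_norm_bounded (norm_zpow_mul_mul_latticeBessel_le hw0 hu k)

theorem zpow_mul_abs_latticeFourier_le (hp0 : 0 < p) (hp1 : p < 1) (hw0 : 0 < w) (hτ0 : 0 < τ)
    (hwτ : w * τ < 1) (hu : ∀ n, |u n| ≤ A * τ ^ n) (k : ℤ) :
    w ^ k * |latticeFourier p w u k| ≤
      A * τ ^ (-k) * ∑' m : ℤ, (w * τ) ^ m * |latticeBessel p w m| := by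
  have hmajorant :=
    (summable_zpow_mul_abs_latticeBessel_add hp0 hp1 w (mul_pos hw0 hτ0) hwτ k).mul_left A
  calc w ^ k * |latticeFourier p w u k|
      ≤ w ^ k * ∑' n : ℤ, A * ((w * τ) ^ n * |latticeBessel p w (n + k)|) := by
        gcongr
        exact tsum_of_norm_bounded hmajorant.hasSum (norm_zpow_mul_mul_latticeBessel_le hw0 hu k)
    _ = w ^ k * ∑' m : ℤ, A * ((w * τ) ^ (m - k) * |latticeBessel p w m|) := by
        rw [← (Equiv.subRight k).tsum_eq]
        simp only [Equiv.subRight_apply, sub_add_cancel]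
    _ = A * τ ^ (-k) * ∑' m : ℤ, (w * τ) ^ m * |latticeBessel p w m| := by
        rw [← tsum_mul_left, ← tsum_mul_left]
        refine tsum_congr fun m => ?_
        rw [zpow_sub₀ (mul_pos hw0 hτ0).ne', mul_zpow w τ k, zpow_neg]
        field_simp

theorem latticeFourier_const (hp0 : 0 < p) (hp1 : p < 1) (hw0 : 0 < w) (hw1 : w < 1) (c : ℝ)
    (k : ℤ) : latticeFourier p w (fun _ => c) k = 0 :=
  calc latticeFourier p w (fun _ => c) k
      = ∑' m : ℤ, c * w ^ (-k) * (w ^ m * latticeBessel p w m) := by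
        rw [latticeFourier, ← (Equiv.subRight k).tsum_eq]
        refine tsum_congr fun m => ?_
        rw [Equiv.subRight_apply, sub_add_cancel, sub_eq_add_neg, zpow_add₀ hw0.ne']
        ring
    _ = 0 := by rw [tsum_mul_left, tsum_zpow_mul_latticeBessel hp0 hp1 hw0 hw1, mul_zero]

theorem latticeFourier_sub_const (hp0 : 0 < p) (hp1 : p < 1) (hw0 : 0 < w) (hw1 : w < 1) (c : ℝ)
    {k : ℤ} (hu : Summable fun n : ℤ => w ^ n * u n * latticeBessel p w (n + k)) :
    latticeFourier p w (fun n => u n - c) k = latticeFourier p w u k := by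
  have hc : Summable fun n : ℤ => w ^ n * c * latticeBessel p w (n + k) :=
    summable_zpow_mul_mul_latticeBessel (u := fun _ => c) (A := |c|) hp0 hp1 hw0 one_pos
      (by rwa [mul_one]) (fun n => by rw [one_zpow, mul_one]) k
  have hzero : ∑' n : ℤ, w ^ n * c * latticeBessel p w (n + k) = 0 :=
    latticeFourier_const hp0 hp1 hw0 hw1 c k
  simp only [latticeFourier, mul_sub, sub_mul]
  rw [hu.tsum_sub hc, hzero, sub_zero]

theorem summable_zpow_mul_abs_latticeFourier (hp0 : 0 < p) (hp1 : p < 1) (hw0 : 0 < w)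
    (hτ1 : 1 < τ) (hwτ : w * τ < 1) (hu : ∀ n, |u n| ≤ A * τ ^ n) {A' σ c : ℝ} (hσ0 : 0 < σ)
    (hσ1 : σ < 1) (hc : ∀ n, |u n - c| ≤ A' * σ ^ n) :
    Summable fun k : ℤ => w ^ k * |latticeFourier p w u k| := by
  have hτ0 : 0 < τ := one_pos.trans hτ1
  have hw1 : w < 1 := (le_mul_of_one_le_right hw0.le hτ1.le).trans_lt hwτ
  have hterm (k : ℤ) : ‖w ^ k * |latticeFourier p w u k|‖ = w ^ k * |latticeFourier p w u k| :=
    Real.norm_of_nonneg (mul_nonneg (zpow_pos hw0 k).le (abs_nonneg _))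
  -- As `k → -∞` the bound from `hu` does not decay, so `c` is subtracted from `u`: this does not
  -- change the transform and replaces `τ` by `σ`.
  refine Summable.of_nat_of_neg ?_ ?_
  · have hgeometric := summable_geometric_of_lt_one (inv_pos.2 hτ0).le (inv_lt_one_of_one_lt₀ hτ1)
    refine ((hgeometric.mul_left A).mul_right
      (∑' m : ℤ, (w * τ) ^ m * |latticeBessel p w m|)).of_norm_bounded fun n => ?_
    rw [hterm, inv_pow, ← zpow_natCast, ← zpow_neg]
    exact zpow_mul_abs_latticeFourier_le hp0 hp1 hw0 hτ0 hwτ hu n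
  · have hwσ : w * σ < 1 := mul_lt_one_of_nonneg_of_lt_one_left hw0.le hw1 hσ1.le
    refine (((summable_geometric_of_lt_one hσ0.le hσ1).mul_left A').mul_right
      (∑' m : ℤ, (w * σ) ^ m * |latticeBessel p w m|)).of_norm_bounded fun n => ?_
    rw [hterm, ← latticeFourier_sub_const hp0 hp1 hw0 hw1 c
      (summable_zpow_mul_mul_latticeBessel hp0 hp1 hw0 hτ0 hwτ hu _)]
    have hbound := zpow_mul_abs_latticeFourier_le hp0 hp1 hw0 hσ0 hwσ hc (-n)
    rwa [neg_neg, zpow_natCast] at hbound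

theorem summable_latticeFourier_kernel (hp0 : 0 < p) (hp1 : p < 1) (hw0 : 0 < w) (hτ1 : 1 < τ)
    (hwτ : w * τ < 1) (hu : ∀ n, |u n| ≤ A * τ ^ n) (l : ℤ) :
    Summable fun x : ℤ × ℤ => w ^ x.1 * (w ^ x.2 * u x.2 * latticeBessel p w (x.2 + x.1)) *
      latticeBessel p w (x.1 + l) := by
  have hτ0 : 0 < τ := one_pos.trans hτ1
  have houter := summable_zpow_mul_abs_latticeBessel_add hp0 hp1 w (inv_pos.2 hτ0)
    (inv_lt_one_of_one_lt₀ hτ1) l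
  have hinner := (rapidlyDecaying_latticeBessel hp0 hp1 w).summable_zpow_mul_abs
    (mul_pos hw0 hτ0) hwτ
  have hmajorant := (summable_comp_add_iff fun k : ℤ => k).2
    (summable_mul_of_summable_norm houter.norm hinner.norm)
  refine (hmajorant.mul_left A).of_norm_bounded fun x => ?_
  obtain ⟨k, n⟩ := x
  calc ‖w ^ k * (w ^ n * u n * latticeBessel p w (n + k)) * latticeBessel p w (k + l)‖
      = w ^ k * ‖w ^ n * u n * latticeBessel p w (n + k)‖ * |latticeBessel p w (k + l)| := by
        rw [norm_mul, norm_mul, Real.norm_of_nonneg (zpow_pos hw0 k).le, ← Real.norm_eq_abs]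
    _ ≤ w ^ k * (A * ((w * τ) ^ n * |latticeBessel p w (n + k)|)) *
          |latticeBessel p w (k + l)| := by
        gcongr
        exact norm_zpow_mul_mul_latticeBessel_le hw0 hu k n
    _ = A * (τ⁻¹ ^ k * |latticeBessel p w (k + l)| *
          ((w * τ) ^ (n + k) * |latticeBessel p w (n + k)|)) := by
        rw [zpow_add₀ (mul_pos hw0 hτ0).ne', mul_zpow w τ k, inv_zpow]
        field_simp

theorem hasSum_latticeFourier_mul_latticeBessel (hp0 : 0 < p) (hp1 : p < 1) (hw0 : 0 < w)
    (hτ1 : 1 < τ) (hwτ : w * τ < 1) (hu : ∀ n, |u n| ≤ A * τ ^ n) (l : ℤ) :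
    HasSum (fun k : ℤ => w ^ k * latticeFourier p w u k * latticeBessel p w (k + l)) (u l) := by
  have hw1 : w < 1 := (le_mul_of_one_le_right hw0.le hτ1.le).trans_lt hwτ
  let H (k n : ℤ) : ℝ :=
    w ^ k * (w ^ n * u n * latticeBessel p w (n + k)) * latticeBessel p w (k + l)
  have hH : Summable (Function.uncurry H) := summable_latticeFourier_kernel hp0 hp1 hw0 hτ1 hwτ hu l
  have hinner (k : ℤ) :
      ∑' n : ℤ, H k n = w ^ k * latticeFourier p w u k * latticeBessel p w (k + l) := by
    rw [tsum_mul_right, tsum_mul_left, latticeFourier]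
  have houter (n : ℤ) : ∑' k : ℤ, H k n = w ^ n * u n * if n = l then w ^ (-n) else 0 := by
    rw [← tsum_zpow_mul_latticeBessel_add_mul hp0 hp1 hw0 hw1, ← tsum_mul_left]
    refine tsum_congr fun k => ?_
    simp only [H, add_comm k n]
    ring
  have htotal : ∑' (k : ℤ) (n : ℤ), H k n = u l := by
    rw [← hH.tsum_comm, tsum_congr houter,
      tsum_eq_single l fun n hn => by rw [if_neg hn, mul_zero], if_pos rfl, zpow_neg]
    field_simp
  rw [← htotal, ← funext hinner]
  exact hH.prod.hasSum

end LatticeFourier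

/-! ### The q-Bessel Fourier transform -/

section QFourier

variable {q ν : ℝ}

theorem rpow_two_mul_add_two (hq0 : 0 ≤ q) (ν : ℝ) : q ^ (2 * ν + 2) = (q ^ 2) ^ (ν + 1) := by
  rw [← Real.rpow_two, ← Real.rpow_mul hq0, mul_add_one]

theorem zpow_mul_zpow_rpow (hq0 : 0 < q) (ν : ℝ) (n : ℤ) :
    q ^ n * (q ^ n) ^ (2 * ν + 1) = ((q ^ 2) ^ (ν + 1)) ^ n := by
  have hexp : 2 * ν + 2 = 1 + (2 * ν + 1) := by ring
  rw [← Real.rpow_intCast_mul hq0.le, mul_comm (n : ℝ), Real.rpow_mul_intCast hq0.le, ← mul_zpow,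
    ← rpow_two_mul_add_two hq0.le, hexp, Real.rpow_add hq0 1, Real.rpow_one]

theorem cConst_mul_one_sub_ne_zero (hq0 : 0 < q) (hq1 : q < 1) (hν : -1 < ν) :
    cConst q ν * (1 - q) ≠ 0 := by
  have hp0 : 0 ≤ q ^ 2 := sq_nonneg q
  have hp1 : q ^ 2 < 1 := pow_lt_one₀ hq0.le hq1 two_ne_zero
  have hw1 : q ^ (2 * ν + 2) < 1 := Real.rpow_lt_one hq0.le hq1 (by linarith)
  have hq : 1 - q ≠ 0 := sub_ne_zero.2 hq1.ne'
  exact mul_ne_zero (mul_ne_zero (one_div_ne_zero hq)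
    (div_ne_zero (qPochInf_ne_zero hp0 hp1 hw1) (qPochInf_ne_zero hp0 hp1 hp1))) hq

theorem cConst_mul_besselj_zpow (hq0 : 0 < q) (hq1 : q < 1) (hν : -1 < ν) (m : ℤ) :
    cConst q ν * (1 - q) * besselj ν (q ^ m) (q ^ 2) =
      latticeBessel (q ^ 2) ((q ^ 2) ^ (ν + 1)) m := by
  have hp0 : 0 < q ^ 2 := pow_pos hq0 2
  have hp1 : q ^ 2 < 1 := pow_lt_one₀ hq0.le hq1 two_ne_zero
  have hw1 : (q ^ 2) ^ (ν + 1) < 1 := Real.rpow_lt_one hp0.le hp1 (by linarith)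
  have hq : 1 - q ≠ 0 := sub_ne_zero.2 hq1.ne'
  rw [← qPochInf_div_mul_tsum_eq_latticeBessel hp0 hp1 hw1, cConst, rpow_two_mul_add_two hq0.le]
  congr 1
  · field_simp
  · refine tsum_congr fun n => ?_
    rw [pow_mul, ← zpow_natCast (q ^ m) 2, zpow_comm, zpow_natCast]

theorem cConst_mul_fourierIntegrand_zpow (hq0 : 0 < q) (hq1 : q < 1) (hν : -1 < ν) (f : ℝ → ℝ)
    (k n : ℤ) :
    cConst q ν * (1 - q) * (q ^ n * fourierIntegrand q ν f (q ^ k) (q ^ n)) =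
      ((q ^ 2) ^ (ν + 1)) ^ n * f (q ^ n) *
        latticeBessel (q ^ 2) ((q ^ 2) ^ (ν + 1)) (n + k) := by
  rw [← cConst_mul_besselj_zpow hq0 hq1 hν, ← zpow_mul_zpow_rpow hq0, fourierIntegrand,
    add_comm n, zpow_add₀ hq0.ne']
  ring

theorem jacksonIntegrable_fourierIntegrand_zpow_iff (hq0 : 0 < q) (hq1 : q < 1) (hν : -1 < ν)
    {f : ℝ → ℝ} {k : ℤ} :
    JacksonIntegrable q (fourierIntegrand q ν f (q ^ k)) ↔
      Summable fun n : ℤ => ((q ^ 2) ^ (ν + 1)) ^ n * f (q ^ n) *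
        latticeBessel (q ^ 2) ((q ^ 2) ^ (ν + 1)) (n + k) := by
  simp only [← cConst_mul_fourierIntegrand_zpow hq0 hq1 hν]
  exact (summable_mul_left_iff (cConst_mul_one_sub_ne_zero hq0 hq1 hν)).symm

theorem qFourier_zpow (hq0 : 0 < q) (hq1 : q < 1) (hν : -1 < ν) (f : ℝ → ℝ) (k : ℤ) :
    qFourier q ν f (q ^ k) =
      latticeFourier (q ^ 2) ((q ^ 2) ^ (ν + 1)) (fun n => f (q ^ n)) k := by
  rw [qFourier, jacksonIntegral, ← mul_assoc, ← tsum_mul_left, latticeFourier]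
  exact tsum_congr (cConst_mul_fourierIntegrand_zpow hq0 hq1 hν f k)

theorem mem_qLp_one_iff (hq0 : 0 < q) {f : ℝ → ℝ} :
    f ∈ qLp q 1 ν ↔ Summable fun n : ℤ => ((q ^ 2) ^ (ν + 1)) ^ n * |f (q ^ n)| := by
  refine summable_congr fun n => ?_
  beta_reduce
  rw [Real.rpow_one, ← zpow_mul_zpow_rpow hq0]
  ring

variable {f : ℝ → ℝ} {A τ x : ℝ}

theorem jacksonIntegrable_fourierIntegrand (hq0 : 0 < q) (hq1 : q < 1) (hν : -1 < ν)
    (hτ0 : 0 < τ) (hwτ : (q ^ 2) ^ (ν + 1) * τ < 1) (hf : ∀ n : ℤ, |f (q ^ n)| ≤ A * τ ^ n)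
    (hx : x ∈ qHalfLine q) : JacksonIntegrable q (fourierIntegrand q ν f x) := by
  obtain ⟨k, rfl⟩ := hx
  have hp0 : 0 < q ^ 2 := pow_pos hq0 2
  exact (jacksonIntegrable_fourierIntegrand_zpow_iff hq0 hq1 hν).2
    (summable_zpow_mul_mul_latticeBessel hp0 (pow_lt_one₀ hq0.le hq1 two_ne_zero)
      (Real.rpow_pos_of_pos hp0 _) hτ0 hwτ hf k)

theorem qFourier_mem_qLp_one (hq0 : 0 < q) (hq1 : q < 1) (hν : -1 < ν) (hτ1 : 1 < τ)
    (hwτ : (q ^ 2) ^ (ν + 1) * τ < 1) (hf : ∀ n : ℤ, |f (q ^ n)| ≤ A * τ ^ n) {A' σ c : ℝ}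
    (hσ0 : 0 < σ) (hσ1 : σ < 1) (hc : ∀ n : ℤ, |f (q ^ n) - c| ≤ A' * σ ^ n) :
    qFourier q ν f ∈ qLp q 1 ν := by
  have hp0 : 0 < q ^ 2 := pow_pos hq0 2
  simp only [mem_qLp_one_iff hq0, qFourier_zpow hq0 hq1 hν]
  exact summable_zpow_mul_abs_latticeFourier hp0 (pow_lt_one₀ hq0.le hq1 two_ne_zero)
    (Real.rpow_pos_of_pos hp0 _) hτ1 hwτ hf hσ0 hσ1 hc

theorem jacksonIntegrable_and_qFourier_qFourier_eq (hq0 : 0 < q) (hq1 : q < 1) (hν : -1 < ν)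
    (hτ1 : 1 < τ) (hwτ : (q ^ 2) ^ (ν + 1) * τ < 1) (hf : ∀ n : ℤ, |f (q ^ n)| ≤ A * τ ^ n)
    (hx : x ∈ qHalfLine q) :
    JacksonIntegrable q (fourierIntegrand q ν (qFourier q ν f) x) ∧
      qFourier q ν (qFourier q ν f) x = f x := by
  obtain ⟨l, rfl⟩ := hx
  have hp0 : 0 < q ^ 2 := pow_pos hq0 2
  have hinversion := hasSum_latticeFourier_mul_latticeBessel hp0
    (pow_lt_one₀ hq0.le hq1 two_ne_zero) (Real.rpow_pos_of_pos hp0 _) hτ1 hwτ hf l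
  simp only [← qFourier_zpow hq0 hq1 hν] at hinversion
  refine ⟨(jacksonIntegrable_fourierIntegrand_zpow_iff hq0 hq1 hν).2 hinversion.summable, ?_⟩
  rw [qFourier_zpow hq0 hq1 hν]
  exact hinversion.tsum_eq

end QFourier

section Macdonald

variable {p : ℝ}

theorem macdonaldIntegrand_eq_fourierIntegrand (q ν x : ℝ) :
    macdonaldIntegrand q ν x = fourierIntegrand q ν (fun t => (1 + t ^ 2)⁻¹) x := by
  funext t
  rw [macdonaldIntegrand, fourierIntegrand, mul_comm t x]

theorem macdonaldK_eq_qFourier (q ν : ℝ) :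
    macdonaldK q ν = qFourier q ν fun t => (1 + t ^ 2)⁻¹ := by
  funext x
  rw [macdonaldK, qFourier, macdonaldIntegrand_eq_fourierIntegrand]

theorem abs_inv_one_add_zpow_le (hp0 : 0 < p) {τ : ℝ} (hτ1 : 1 ≤ τ) (hpτ : p * τ ≤ 1) (n : ℤ) :
    |(1 + p ^ n)⁻¹| ≤ τ ^ n := by
  have hτ0 : 0 < τ := one_pos.trans_le hτ1
  have hpn : 0 < p ^ n := zpow_pos hp0 n
  rw [abs_of_pos (inv_pos.2 (by positivity)), inv_le_iff_one_le_mul₀ (by positivity)]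
  rcases le_total 0 n with hn | hn
  · exact one_le_mul_of_one_le_of_one_le (one_le_zpow₀ hτ1 hn) (by linarith)
  · have hpow : 1 ≤ (p * τ) ^ n := one_le_zpow_of_nonpos₀ (mul_pos hp0 hτ0) hpτ hn
    rw [mul_zpow] at hpow
    linarith [zpow_pos hτ0 n]

theorem abs_inv_one_add_sub_one_le {y : ℝ} (hy : 0 ≤ y) : |(1 + y)⁻¹ - 1| ≤ y := by
  have hone : (1 + y)⁻¹ ≤ 1 := inv_le_one_of_one_le₀ (by linarith)
  rw [abs_sub_comm, abs_of_nonneg (sub_nonneg.2 hone)]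
  rw [sub_le_comm, ← one_div, le_div_iff₀ (by linarith)]
  linarith [mul_self_nonneg y]

theorem exists_one_lt_of_mul_lt_one {a b : ℝ} (ha0 : 0 < a) (ha1 : a < 1) (hb1 : b < 1) :
    ∃ τ : ℝ, 1 < τ ∧ a * τ < 1 ∧ b * τ < 1 := by
  obtain ⟨ρ, hρ, hρ1⟩ := exists_between (max_lt ha1 hb1)
  obtain ⟨haρ, hbρ⟩ := max_lt_iff.1 hρ
  have hρ0 : 0 < ρ := ha0.trans haρ
  exact ⟨ρ⁻¹, (one_lt_inv₀ hρ0).2 hρ1, (mul_inv_lt_iff₀ hρ0).2 (by rwa [one_mul]),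
    (mul_inv_lt_iff₀ hρ0).2 (by rwa [one_mul])⟩

end Macdonald

end QBessel

end

theorem mainTheorem5_general (q ν : ℝ) (hq0 : 0 < q) (hq1 : q < 1) (hν : -1 < ν) :
    (∀ x ∈ QBessel.qHalfLine q,
      QBessel.JacksonIntegrable q (QBessel.macdonaldIntegrand q ν x)) ∧
    QBessel.macdonaldK q ν ∈ QBessel.qLp q 1 ν ∧
    ∀ x ∈ QBessel.qHalfLine q,
      QBessel.JacksonIntegrable q
        (QBessel.fourierIntegrand q ν (QBessel.macdonaldK q ν) x) ∧
      QBessel.qFourier q ν (QBessel.macdonaldK q ν) x = (1 + x ^ 2)⁻¹ := by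
  have hp0 : 0 < q ^ 2 := pow_pos hq0 2
  have hp1 : q ^ 2 < 1 := pow_lt_one₀ hq0.le hq1 two_ne_zero
  have hw1 : (q ^ 2) ^ (ν + 1) < 1 := Real.rpow_lt_one hp0.le hp1 (by linarith)
  obtain ⟨τ, hτ1, hpτ, hwτ⟩ := QBessel.exists_one_lt_of_mul_lt_one hp0 hp1 hw1
  have hsq (n : ℤ) : (q ^ n) ^ 2 = (q ^ 2) ^ n := by
    rw [← zpow_natCast, ← zpow_natCast, zpow_comm]
  have hgrowth (n : ℤ) : |(1 + (q ^ n) ^ 2)⁻¹| ≤ 1 * τ ^ n := by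
    rw [hsq, one_mul]
    exact QBessel.abs_inv_one_add_zpow_le hp0 hτ1.le hpτ.le n
  have hzero (n : ℤ) : |(1 + (q ^ n) ^ 2)⁻¹ - 1| ≤ 1 * (q ^ 2) ^ n := by
    rw [hsq, one_mul]
    exact QBessel.abs_inv_one_add_sub_one_le (zpow_pos hp0 n).le
  simp only [QBessel.macdonaldIntegrand_eq_fourierIntegrand, QBessel.macdonaldK_eq_qFourier]
  exact ⟨fun x => QBessel.jacksonIntegrable_fourierIntegrand hq0 hq1 hν (one_pos.trans hτ1) hwτ
      hgrowth,
    QBessel.qFourier_mem_qLp_one hq0 hq1 hν hτ1 hwτ hgrowth hp0 hp1 hzero,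
    fun x => QBessel.jacksonIntegrable_and_qFourier_qFourier_eq hq0 hq1 hν hτ1 hwτ hgrowth⟩

theorem mainTheorem5 (q ν : ℝ) (hq0 : 0 < q) (hq1 : q < 1) (hν : -1 < ν)
    (hνN : ∀ m : ℕ, 1 ≤ m → ν ≠ (m : ℝ)) :
    (∀ x ∈ QBessel.qHalfLine q,
      QBessel.JacksonIntegrable q (QBessel.macdonaldIntegrand q ν x)) ∧
    QBessel.macdonaldK q ν ∈ QBessel.qLp q 1 ν ∧
    ∀ x ∈ QBessel.qHalfLine q,
      QBessel.JacksonIntegrable q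
        (QBessel.fourierIntegrand q ν (QBessel.macdonaldK q ν) x) ∧
      QBessel.qFourier q ν (QBessel.macdonaldK q ν) x = (1 + x ^ 2)⁻¹ :=
  mainTheorem5_general q ν hq0 hq1 hν
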